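/- Let $\mu,\nu\ge 0$ be integers of the same parity and let $z\in\mathbb{C}$, $z\neq 0$. Write ${}_pF_q(a_1,\dots,a_p;b_1,\dots,b_q;z)=\sum_{n\ge0}\frac{(a_1)_n\cdots(a_p)_n}{(b_1)_n\cdots(b_q)_n}\frac{z^n}{n!}$, let ${}_p\tilde F_q$ be the regularized function, in which each $(b_i)_n$ is replaced by $\Gamma(b_i+n)$ (with $1/\Gamma=0$ at $0,-1,-2,\dots$), and put $\binom{x}{y}=\frac{\Gamma(x+1)}{\Gamma(y+1)\Gamma(x-y+1)}$. Then $$ {}_3F_4\left(\tfrac{\mu}{2}+\tfrac{\nu}{2}+\tfrac12,\tfrac{\mu}{2}+\tfrac{\nu}{2}+1,\tfrac{\mu}{2}+\tfrac{\nu}{2}+\tfrac32;\ \mu+1,\nu+1,\mu+\nu+1,\tfrac{\mu}{2}+\tfrac{\nu}{2}+\tfrac52;\ z\right) = C_{\mu\nu}(z)\sum_{L=0}^{\infty} c_L^{\mu\nu}(z)\,A_{L}^{\mu}(z)\,A_{L}^{\nu}(z), $$ where $$ C_{\mu\nu}(z)=\pi\, i^{-\mu-\nu}\,2^{\mu+\nu-2}\,\Gamma(\mu+1)\Gamma(\nu+1)(\mu+\nu+3)\,z^{\frac12(-\mu-\nu)},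 $$ $$ c_L^{\mu\nu}(z)=\frac{i^{2L-2}2^{2-4L}\left(1+(-1)^{L+\mu+1}\right)\left(1+(-1)^{L+\nu+1}\right)(-1)^{L-\frac{\mu}{2}-\frac{\nu}{2}-1}}{2L+1}\,z^{L-1}, $$ the series over $L$ converges absolutely, and for $N\in\{\mu,\nu\}$ $$ \begin{aligned} A_L^N(z)={}&\frac{L}{\Gamma\left(\frac{2L+1}{2}\right)}\binom{L-1}{\frac{L-N-1}{2}}\,{}_2F_3\left(\tfrac L2+\tfrac12,\tfrac L2;\ L+\tfrac12,\tfrac L2-\tfrac N2+\tfrac12,\tfrac L2+\tfrac N2+\tfrac12;\ \tfrac z4\right)\\ &+\frac{(L+1)\,z}{16\,\Gamma\left(\frac{2L+5}{2}\right)}\binom{L+1}{\frac{L-N+1}{2}}\,{}_2F_3\left(\tfrac L2+1,\tfrac L2+\tfrac32;\ L+\tfrac52,\tfrac L2-\tfrac N2+\tfrac32,\tfrac L2+\tfrac N2+\tfrac32;\ \tfrac z4\right). \end{aligned} $$ Here the first summand is $0$ for $L=0$, and whenever a lower parameter of a ${}_2F_3$ is a non-positive integer, the summand containing it (an indeterminate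 product of a vanishing binomial coefficient and an infinite ${}_2F_3$) is understood as its limit as the index $N$ is approached through complex values, with $L$ fixed; this limit always exists. The same identity, with the same $C_{\mu\nu}$ and $c_L^{\mu\nu}$ and with absolute convergence of the series over $L$, holds with $A_L^N(z)$ given in regularized form by $$ \begin{aligned} A_L^N(z)={}&\Gamma(L+1)\,{}_2\tilde F_3\left(\tfrac L2+\tfrac12,\tfrac L2;\ L+\tfrac12,\tfrac L2-\tfrac N2+\tfrac12,\tfrac L2+\tfrac N2+\tfrac12;\ \tfrac z4\right)\\ &+\tfrac1{16}(L+1)\Gamma(L+2)\,z\,{}_2\tilde F_3\left(\tfrac L2+1,\tfrac L2+\tfrac32;\ L+\tfrac52,\tfrac L2-\tfrac N2+\tfrac32,\tfrac L2+\tfrac N2+\tfrac32;\ \tfrac z4\right). \end{aligned} $$ -/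

import Mathlib

open scoped Nat

noncomputable section

namespace HypergeometricSum

/-- The conventional generalized hypergeometric function with upper parameters `a` and lower
parameters `b` (multisets, so that repeated parameters count with their multiplicity):
`∑ₙ ∏ (a)ₙ / ∏ (b)ₙ · zⁿ / n!`. It is meaningful when no lower parameter is one of
`0, -1, -2, …`, and it is only used for such parameters. The regularized function, in which
`(b)ₙ` is replaced by `Γ(b + n)`, is Mathlib's `Complex.regularizedHGFun`. -/
def hypergeom (a b : Multiset ℂ) (z : ℂ) : ℂ :=
  ∑' n : ℕ, (a.map (ascPochhammer ℂ n).eval).prod /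
    (n ! * (b.map (ascPochhammer ℂ n).eval).prod) * z ^ n

/-- The binomial coefficient with complex entries, `Γ(x+1) / (Γ(y+1) Γ(x-y+1))`. Mathlib's `Gamma`
vanishes at `0, -1, -2, …`, hence the reciprocal Gamma factors have their correct value `0`
there. -/
def cbinom (x y : ℂ) : ℂ :=
  Complex.Gamma (x + 1) * (Complex.Gamma (y + 1))⁻¹ * (Complex.Gamma (x - y + 1))⁻¹

/-- The first summand of the factor with index `N`, in conventional hypergeometric functions.
The index `N` is a complex variable here; for `L = 0` the summand is absent (its coefficient `L`
is zero). -/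
def convFirst (L : ℕ) (N z : ℂ) : ℂ :=
  L / Complex.Gamma ((2 * L + 1) / 2) * cbinom (L - 1) ((L - N - 1) / 2) *
    hypergeom {(L : ℂ) / 2 + 1 / 2, (L : ℂ) / 2}
      {(L : ℂ) + 1 / 2, (L : ℂ) / 2 - N / 2 + 1 / 2, (L : ℂ) / 2 + N / 2 + 1 / 2} (z / 4)

/-- The second summand of the factor with index `N`, in conventional hypergeometric functions. -/
def convSecond (L : ℕ) (N z : ℂ) : ℂ :=
  (L + 1) / (16 * Complex.Gamma ((2 * L + 5) / 2)) * z * cbinom (L + 1) ((L - N + 1) / 2) *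
    hypergeom {(L : ℂ) / 2 + 1, (L : ℂ) / 2 + 3 / 2}
      {(L : ℂ) + 5 / 2, (L : ℂ) / 2 - N / 2 + 3 / 2, (L : ℂ) / 2 + N / 2 + 3 / 2} (z / 4)

/-- The factor with index `N`, in regularized hypergeometric functions. -/
def regFactor (L N : ℕ) (z : ℂ) : ℂ :=
  Complex.Gamma (L + 1) *
      Complex.regularizedHGFun {(L : ℂ) / 2 + 1 / 2, (L : ℂ) / 2}
        {(L : ℂ) + 1 / 2, (L : ℂ) / 2 - N / 2 + 1 / 2, (L : ℂ) / 2 + N / 2 + 1 / 2} (z / 4) +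
    1 / 16 * (L + 1) * Complex.Gamma (L + 2) * z *
      Complex.regularizedHGFun {(L : ℂ) / 2 + 1, (L : ℂ) / 2 + 3 / 2}
        {(L : ℂ) + 5 / 2, (L : ℂ) / 2 - N / 2 + 3 / 2, (L : ℂ) / 2 + N / 2 + 3 / 2} (z / 4)

/-- The prefactor in front of the sum over `L`. -/
def prefactor (μ ν : ℕ) (z : ℂ) : ℂ :=
  Real.pi * Complex.I ^ (-(μ : ℤ) - ν) * 2 ^ ((μ : ℤ) + ν - 2) *
    Complex.Gamma (μ + 1) * Complex.Gamma (ν + 1) * (μ + ν + 3) *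
    z ^ ((1 / 2 : ℂ) * (-(μ : ℂ) - ν))

/-- The coefficient, with its power of `z`, of the product of the two factors in the `L`-th
term. -/
def coeff (μ ν : ℕ) (z : ℂ) (L : ℕ) : ℂ :=
  Complex.I ^ (2 * (L : ℤ) - 2) * 2 ^ (2 - 4 * (L : ℤ)) *
    (1 + (-1) ^ (L + μ + 1)) * (1 + (-1) ^ (L + ν + 1)) *
    (-1 : ℂ) ^ ((L : ℂ) - μ / 2 - ν / 2 - 1) / (2 * L + 1) * z ^ ((L : ℤ) - 1)

/-- The left-hand side, a conventional `₃F₄`. -/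
def lhs (μ ν : ℕ) (z : ℂ) : ℂ :=
  hypergeom
    {(μ : ℂ) / 2 + ν / 2 + 1 / 2, (μ : ℂ) / 2 + ν / 2 + 1, (μ : ℂ) / 2 + ν / 2 + 3 / 2}
    {(μ : ℂ) + 1, (ν : ℂ) + 1, (μ : ℂ) + ν + 1, (μ : ℂ) / 2 + ν / 2 + 5 / 2} z

end HypergeometricSum

end

/-!
Put `B_N(x) = ∑ j, (z/4)^j / (j! (N+j)!) * x^(N+1+2j)`, that is, `x` times a Bessel function of
order `N`, up to normalization. Expand `B_μ` and `B_ν` in Legendre polynomials on `[-1, 1]`. The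
left-hand side is a constant multiple of the integral of `B_μ B_ν` over `[-1, 1]`
(`lhs_eq_tsum`, where the Cauchy product of the two series is summed by Vandermonde's identity),
and the right-hand side is the corresponding sum of products of Legendre coefficients, so that the
theorem is Parseval's identity.

No integral or completeness theorem is needed. The moments `∫ x^a P_L` have a closed form,
`legendreMoment`, and Parseval's identity for two monomials is a finite telescoping sum in `L`
(`hasSum_legendreMoment_mul`). All moments are nonnegative, hence the triple series over `L` and
the two exponents converges absolutely and may be rearranged (`hasSum_legendre_parseval`).

The two summands of the factor with index `N` combine into one power series whose coefficients are
moments (`regFactor_eq_tsum`, `regFactor_eq_legendre`); the remaining constants cancel in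
`summand_eq_legendre`. The form with conventional hypergeometric functions follows since each
summand agrees with its regularized version as long as no lower parameter is a pole of Gamma, and
the regularized version is continuous in the index (`continuous_regularizedHGFun`). The only
discrepancy is the first summand for `L = 0`, where either the coefficient vanishes or the
regularized summand does.
-/

namespace HypergeometricSum

/-! ### Moments of Legendre polynomials -/

/-- The moment `∫ x in -1..1, x ^ a * P_L(x)` of the Legendre polynomial `P_L`, in closed form. -/
noncomputable def legendreMoment (L a : ℕ) : ℝ :=
  if L ≤ a ∧ Even (a - L) then 2 * (a ! : ℝ) / ((a - L)‼ * (a + L + 1)‼) else 0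

lemma legendreMoment_nonneg (L a : ℕ) : 0 ≤ legendreMoment L a := by
  unfold legendreMoment
  split_ifs <;> positivity

lemma legendreMoment_eq_zero_of_lt {L a : ℕ} (h : a < L) : legendreMoment L a = 0 := by
  rw [legendreMoment, if_neg (by omega)]

lemma legendreMoment_eq_zero_of_odd {L a : ℕ} (h : Odd (L + a)) : legendreMoment L a = 0 := by
  rw [legendreMoment, if_neg]
  rintro ⟨h1, h2⟩
  rw [Nat.even_iff] at h2
  rw [Nat.odd_iff] at h
  omega

lemma legendreMoment_add_two_mul (L n : ℕ) :
    legendreMoment L (L + 2 * n) = 2 * (L + 2 * n)! / (2 ^ n * n ! * (2 * (L + n) + 1)‼) := by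
  have h : L + 2 * n - L = 2 * n := by omega
  rw [legendreMoment, if_pos ⟨by omega, by rw [h]; exact even_two_mul n⟩, h,
    Nat.doubleFactorial_two_mul, show L + 2 * n + L + 1 = 2 * (L + n) + 1 by ring]
  push_cast
  rfl

/-- The recurrence in the degree that makes Parseval's identity for monomials telescope. -/
lemma legendreMoment_add_two (L a : ℕ) :
    (a + L + 3) * legendreMoment (L + 2) a = ((a : ℝ) - L) * legendreMoment L a := by
  rcases lt_or_ge a L with h | h
  · rw [legendreMoment_eq_zero_of_lt h, legendreMoment_eq_zero_of_lt (by omega)]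
    simp
  · obtain ⟨n, rfl | rfl⟩ : ∃ n, a = L + 2 * n ∨ a = L + (2 * n + 1) := by
      obtain ⟨m, hm⟩ := Nat.even_or_odd' (a - L)
      exact ⟨m, by omega⟩
    · rcases n with _ | n
      · rw [legendreMoment_eq_zero_of_lt (by omega)]
        simp
      · have e : L + 2 * (n + 1) = (L + 2) + 2 * n := by ring
        conv_lhs => rw [e, legendreMoment_add_two_mul]
        rw [legendreMoment_add_two_mul, e]
        rw [show 2 * (L + 2 + n) + 1 = 2 * (L + (n + 1)) + 1 + 2 by ring,
          Nat.doubleFactorial_add_two, Nat.factorial_succ]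
        have : ((2 * (L + (n + 1)) + 1)‼ : ℝ) ≠ 0 := by positivity
        push_cast
        field_simp
        ring
    · rw [legendreMoment_eq_zero_of_odd (L := L) ⟨L + n, by ring⟩,
        legendreMoment_eq_zero_of_odd (L := L + 2) ⟨L + n + 1, by ring⟩]
      simp

/-- The remainder of the Legendre expansion of `∫ x in -1..1, x ^ a * x ^ b`, when only the
degrees from `L` on, in steps of two, are kept. -/
noncomputable def momentTail (a b L : ℕ) : ℝ :=
  legendreMoment L a * legendreMoment L b * ((a + L + 1) * (b + L + 1)) / (2 * (a + b + 1))

lemma momentTail_sub (a b L : ℕ) :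
    momentTail a b L - momentTail a b (L + 2) =
      (2 * L + 1) / 2 * (legendreMoment L a * legendreMoment L b) := by
  have ha := legendreMoment_add_two L a
  have hb := legendreMoment_add_two L b
  have h : momentTail a b (L + 2) =
      ((a - L) * legendreMoment L a) * ((b - L) * legendreMoment L b) / (2 * (a + b + 1)) := by
    rw [← ha, ← hb, momentTail]
    push_cast
    ring
  rw [h, momentTail]
  field_simp
  ring

lemma momentTail_eq_zero_of_lt {a b L : ℕ} (h : a < L) : momentTail a b L = 0 := by
  simp [momentTail, legendreMoment_eq_zero_of_lt h]

lemma momentTail_zero_add_one {a b : ℕ} (h : Even (a + b)) :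
    momentTail a b 0 + momentTail a b 1 = 2 / (a + b + 1) := by
  have key (L n : ℕ) (hL : L ≤ 1) :
      legendreMoment L (L + 2 * n) * ((L + 2 * n : ℕ) + L + 1) = 2 := by
    rw [legendreMoment_add_two_mul]
    obtain rfl | rfl : L = 0 ∨ L = 1 := by omega
    · have h1 : ((2 * (0 + n) + 1)‼ : ℝ) * (2 ^ n * n !) = (2 * n + 1) * (2 * n)! := by
        have := Nat.factorial_eq_mul_doubleFactorial (2 * n)
        rw [Nat.doubleFactorial_two_mul, Nat.factorial_succ] at this
        rw [zero_add]
        exact_mod_cast this.symm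
      have h2 : (0 : ℝ) < (2 * (0 + n) + 1)‼ := by positivity
      rw [div_mul_eq_mul_div, div_eq_iff (by positivity)]
      push_cast
      simp only [zero_add] at h1 ⊢
      linear_combination -2 * h1
    · have h1 : ((2 * (1 + n) + 1)‼ : ℝ) * (2 ^ n * n !) = (2 * n + 3) * (1 + 2 * n)! := by
        have := Nat.factorial_eq_mul_doubleFactorial (2 * n)
        rw [Nat.doubleFactorial_two_mul] at this
        rw [show 2 * (1 + n) + 1 = 2 * n + 1 + 2 by ring, Nat.doubleFactorial_add_two,
          add_comm 1 (2 * n), this]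
        push_cast
        ring
      have h2 : (0 : ℝ) < (2 * (1 + n) + 1)‼ := by positivity
      rw [div_mul_eq_mul_div, div_eq_iff (by positivity)]
      push_cast
      linear_combination -2 * h1
  have comb (L m n : ℕ) (hL : L ≤ 1) : momentTail (L + 2 * m) (L + 2 * n) L =
      2 / ((L + 2 * m : ℕ) + (L + 2 * n : ℕ) + 1) := by
    rw [momentTail, mul_mul_mul_comm, key L m hL, key L n hL]
    field_simp
  have van (L : ℕ) (ho : Odd (L + a)) : momentTail a b L = 0 := by
    simp [momentTail, legendreMoment_eq_zero_of_odd ho]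
  rcases Nat.even_or_odd' a with ⟨m, rfl | rfl⟩
  · obtain ⟨n, rfl⟩ : ∃ n, b = 2 * n := by
      obtain ⟨r, hr⟩ := h
      exact ⟨r - m, by omega⟩
    rw [van 1 ⟨m, by ring⟩, add_zero]
    simpa using comb 0 m n (by omega)
  · obtain ⟨n, rfl⟩ : ∃ n, b = 1 + 2 * n := by
      obtain ⟨r, hr⟩ := h
      exact ⟨r - m - 1, by omega⟩
    rw [van 0 ⟨m, by ring⟩, zero_add, add_comm (2 * m) 1]
    exact comb 1 m n le_rfl

/-- Parseval's identity for the Legendre expansions of two monomials whose degrees have the same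
parity. It holds because the summands telescope in steps of two. -/
theorem hasSum_legendreMoment_mul {a b : ℕ} (h : Even (a + b)) :
    HasSum (fun L : ℕ => (2 * L + 1) / 2 * (legendreMoment L a * legendreMoment L b))
      (2 / (a + b + 1)) := by
  have tele (n : ℕ) : ∑ L ∈ Finset.range n, (momentTail a b L - momentTail a b (L + 2)) =
      momentTail a b 0 + momentTail a b 1 - momentTail a b n - momentTail a b (n + 1) := by
    induction n with
    | zero => simp
    | succ n ih =>
      rw [Finset.sum_range_succ, ih]
      ring
  have e := tele (a + 1)
  rw [momentTail_eq_zero_of_lt (L := a + 1) (by omega),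
    momentTail_eq_zero_of_lt (L := a + 1 + 1) (by omega),
    momentTail_zero_add_one h, sub_zero, sub_zero] at e
  rw [← e]
  simp_rw [momentTail_sub]
  refine hasSum_sum_of_ne_finset_zero fun L hL => ?_
  rw [legendreMoment_eq_zero_of_lt (a := a) (by simpa using hL)]
  simp

lemma legendreMoment_le_two (L a : ℕ) : legendreMoment L a ≤ 2 := by
  have h := le_hasSum (hasSum_legendreMoment_mul (Even.add_self a)) L fun K _ => by
    have := legendreMoment_nonneg K a
    positivity
  have h2 : (2 : ℝ) / (a + a + 1) ≤ 2 := div_le_self (by norm_num) (by norm_cast; omega)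
  have h3 := legendreMoment_nonneg L a
  have h4 : (0 : ℝ) ≤ L := L.cast_nonneg
  nlinarith [mul_nonneg h4 (mul_nonneg h3 h3)]

/-- Parseval's identity for the Legendre expansions of two absolutely convergent series
`∑ c j * x ^ p j` and `∑ d k * x ^ q k` of monomials of one parity. -/
theorem hasSum_legendre_parseval {c d : ℕ → ℂ} {p q : ℕ → ℕ} (hc : Summable fun j => ‖c j‖)
    (hd : Summable fun k => ‖d k‖) (hpq : ∀ j k, Even (p j + q k)) :
    HasSum (fun L : ℕ => (2 * L + 1) / 2 * ((∑' j, c j * (legendreMoment L (p j) : ℂ)) *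
        ∑' k, d k * (legendreMoment L (q k) : ℂ)))
      (∑' x : ℕ × ℕ, c x.1 * d x.2 * (2 / (p x.1 + q x.2 + 1))) := by
  set v : (ℕ × ℕ) → ℕ → ℝ := fun x L =>
    (2 * L + 1) / 2 * (legendreMoment L (p x.1) * legendreMoment L (q x.2)) with hv
  have hv0 (x L) : 0 ≤ v x L := by
    have := legendreMoment_nonneg L (p x.1)
    have := legendreMoment_nonneg L (q x.2)
    positivity
  have hvs (x) : HasSum (v x) (2 / (p x.1 + q x.2 + 1)) := hasSum_legendreMoment_mul (hpq _ _)
  have hcd : Summable fun x : ℕ × ℕ => ‖c x.1 * d x.2‖ := by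
    simpa only [norm_mul] using hc.mul_of_nonneg hd (fun _ => norm_nonneg _) fun _ => norm_nonneg _
  have hsum : Summable fun y : (ℕ × ℕ) × ℕ => c y.1.1 * d y.1.2 * (v y.1 y.2 : ℂ) := by
    refine Summable.of_norm ?_
    rw [summable_prod_of_nonneg fun _ => norm_nonneg _]
    simp only [norm_mul _ (Complex.ofReal _), Complex.norm_real, Real.norm_eq_abs,
      abs_of_nonneg (hv0 _ _)]
    refine ⟨fun x => (hvs x).summable.mul_left _, ?_⟩
    simp only [tsum_mul_left, (hvs _).tsum_eq]
    refine (hcd.mul_right 2).of_nonneg_of_le (fun x => by positivity) fun x => ?_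
    gcongr
    exact div_le_self (by norm_num) (by norm_cast; omega)
  have hm {e : ℕ → ℂ} (he : Summable fun j => ‖e j‖) (r : ℕ → ℕ) (L : ℕ) :
      Summable fun j => ‖e j * (legendreMoment L (r j) : ℂ)‖ := by
    refine (he.mul_right 2).of_nonneg_of_le (fun _ => norm_nonneg _) fun j => ?_
    rw [norm_mul, Complex.norm_real, Real.norm_eq_abs, abs_of_nonneg (legendreMoment_nonneg _ _)]
    gcongr
    exact legendreMoment_le_two _ _
  have h1 : HasSum (fun y : (ℕ × ℕ) × ℕ => c y.1.1 * d y.1.2 * (v y.1 y.2 : ℂ))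
      (∑' x : ℕ × ℕ, c x.1 * d x.2 * (2 / (p x.1 + q x.2 + 1))) := by
    convert hsum.hasSum using 1
    rw [hsum.tsum_prod]
    refine tsum_congr fun x => ?_
    dsimp only
    rw [tsum_mul_left, (Complex.hasSum_ofReal.mpr (hvs x)).tsum_eq]
    push_cast
    rfl
  have h2 := ((Equiv.prodComm ℕ (ℕ × ℕ)).hasSum_iff.mpr h1)
  refine HasSum.prod_fiberwise h2 fun L => ?_
  rw [tsum_mul_tsum_of_summable_norm (hm hc p L) (hm hd q L)]
  have h3 := (summable_mul_of_summable_norm (hm hc p L) (hm hd q L)).hasSum.mul_left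
    ((2 * L + 1) / 2 : ℂ)
  have h4 : (fun x : ℕ × ℕ => c x.1 * d x.2 * (v x L : ℂ)) = fun x : ℕ × ℕ => (2 * L + 1) / 2 *
      (c x.1 * (legendreMoment L (p x.1) : ℂ) * (d x.2 * (legendreMoment L (q x.2) : ℂ))) := by
    funext x
    simp only [hv]
    push_cast
    ring
  rw [← h4] at h3
  exact h3

/-! ### Regularized hypergeometric series -/

lemma regularizedHGFun_eq_tsum (a b : Multiset ℂ) (z : ℂ) :
    Complex.regularizedHGFun a b z = ∑' n : ℕ, Complex.regularizedHGFunCoeff a b n * z ^ n := by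
  simp [Complex.regularizedHGFun, Complex.regularizedHGFunSeries, FormalMultilinearSeries.sum,
    mul_comm]

lemma summable_regularizedHGFunCoeff {a b : Multiset ℂ} (h : a.card ≤ b.card) (z : ℂ) :
    Summable fun n : ℕ => Complex.regularizedHGFunCoeff a b n * z ^ n := by
  have := (Complex.regularizedHGFunSeries a b).summable (x := z)
    (by simp [Complex.radius_regularizedHGFunSeries_eq_top h])
  simpa [Complex.regularizedHGFunSeries, mul_comm] using this

/-- The conventional hypergeometric function is the regularized one, multiplied by the Gamma
values of the lower parameters. -/
lemma hypergeom_eq_mul_regularizedHGFun {a b : Multiset ℂ} (hb : ∀ c ∈ b, ∀ k : ℕ, c ≠ -k)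
    (z : ℂ) :
    hypergeom a b z = (b.map Complex.Gamma).prod * Complex.regularizedHGFun a b z := by
  rw [hypergeom, regularizedHGFun_eq_tsum, ← tsum_mul_left]
  refine tsum_congr fun n => ?_
  have h : (b.map fun c => Complex.Gamma (c + n)).prod =
      (b.map Complex.Gamma).prod * (b.map (ascPochhammer ℂ n).eval).prod := by
    rw [← Multiset.prod_map_mul]
    refine congrArg _ (Multiset.map_congr rfl fun c hc => ?_)
    rw [← Complex.Gamma_add_nat_div_Gamma_eq c (hb c hc),
      mul_div_cancel₀ _ (Complex.Gamma_ne_zero (hb c hc))]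
  have h0 : (b.map Complex.Gamma).prod ≠ 0 := by
    refine Multiset.prod_ne_zero fun h => ?_
    obtain ⟨c, hc, h⟩ := Multiset.mem_map.mp h
    exact Complex.Gamma_ne_zero (hb c hc) h
  rw [Complex.regularizedHGFunCoeff, h, ← mul_assoc, mul_div_assoc', mul_left_comm (n ! : ℂ),
    mul_div_mul_left _ _ h0]

/-- On bounded sets of parameters the reciprocal Gamma function decays like a reciprocal
factorial, up to a geometric factor, along shifts of the parameter. -/
lemma exists_norm_inv_Gamma_add_nat_le (R : ℝ) :
    ∃ C, 0 ≤ C ∧ ∀ s : ℂ, ‖s‖ ≤ R → ∀ n : ℕ, ‖(Complex.Gamma (s + n))⁻¹‖ ≤ C * (2 ^ n / n !) := by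
  -- From `m` on, `(n + 1) / 2 ≤ ‖s + n‖`, so one more shift gains the factor `2 / (n + 1)`;
  -- the shifts before `m` are bounded by compactness.
  obtain ⟨m, hm⟩ := exists_nat_ge (2 * R + 1)
  have hcont : Continuous fun s : ℂ => (Complex.Gamma s)⁻¹ :=
    Complex.differentiable_one_div_Gamma.continuous
  obtain ⟨B, hB⟩ := (isCompact_closedBall (0 : ℂ) (R + m)).exists_bound_of_continuousOn
    hcont.continuousOn
  have hB' (s : ℂ) (hs : ‖s‖ ≤ R) (n : ℕ) (hn : n ≤ m) : ‖(Complex.Gamma (s + n))⁻¹‖ ≤ |B| := by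
    refine (hB _ ?_).trans (le_abs_self B)
    rw [mem_closedBall_zero_iff]
    refine (norm_add_le _ _).trans ?_
    rw [Complex.norm_natCast]
    have : (n : ℝ) ≤ m := by exact_mod_cast hn
    linarith
  have hpos (n : ℕ) (hn : n ≤ m) : 1 ≤ (m ! : ℝ) * (2 ^ n / n !) := by
    rw [mul_div_assoc', le_div_iff₀ (by positivity), one_mul]
    have h1 : (n ! : ℝ) ≤ m ! := by exact_mod_cast Nat.factorial_le hn
    exact h1.trans (le_mul_of_one_le_right (by positivity) (one_le_pow₀ (by norm_num)))
  refine ⟨|B| * m !, by positivity, fun s hs n => ?_⟩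
  rcases le_total n m with h | h
  · rw [mul_assoc]
    exact (hB' s hs n h).trans (le_mul_of_one_le_right (abs_nonneg _) (hpos n h))
  · induction n, h using Nat.le_induction with
    | base =>
      rw [mul_assoc]
      exact (hB' s hs m le_rfl).trans (le_mul_of_one_le_right (abs_nonneg _) (hpos m le_rfl))
    | succ n hn ih =>
      have hmn : (m : ℝ) ≤ n := by exact_mod_cast hn
      have h1 : ((n : ℝ) + 1) / 2 ≤ ‖s + n‖ := by
        have h2 : ‖(n : ℂ)‖ ≤ ‖s + n‖ + ‖s‖ := by
          simpa using norm_sub_le (s + n) s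
        rw [Complex.norm_natCast] at h2
        linarith
      have h3 := Complex.one_div_Gamma_eq_self_mul_one_div_Gamma_add_one (s + n)
      have h4 : 0 < ‖s + n‖ := lt_of_lt_of_le (by positivity) h1
      rw [h3, norm_mul, ← le_div_iff₀' h4] at ih
      rw [Nat.cast_succ, ← add_assoc]
      refine ih.trans ((div_le_div_of_nonneg_left (by positivity) (by positivity) h1).trans
        (le_of_eq ?_))
      rw [Nat.factorial_succ, pow_succ]
      push_cast
      field_simp

/-- Pochhammer symbols grow at most like a factorial, up to a geometric factor. -/
lemma norm_ascPochhammer_eval_le (a : ℂ) (n : ℕ) :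
    ‖(ascPochhammer ℂ n).eval a‖ ≤ (‖a‖ + 1) ^ n * n ! := by
  induction n with
  | zero => simp
  | succ n ih =>
    rw [ascPochhammer_succ_eval, norm_mul, pow_succ, Nat.factorial_succ]
    have h : ‖a + n‖ ≤ (‖a‖ + 1) * (n + 1) := by
      refine (norm_add_le _ _).trans ?_
      rw [Complex.norm_natCast]
      nlinarith [mul_nonneg (norm_nonneg a) (Nat.cast_nonneg (α := ℝ) n)]
    refine (mul_le_mul ih h (norm_nonneg _) (by positivity)).trans (le_of_eq ?_)
    push_cast
    ring

/-- A regularized `₂F₃` is continuous along a curve of lower parameters. -/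
lemma continuous_regularizedHGFun {f g : ℂ → ℂ} (hf : Continuous f) (hg : Continuous g)
    (a₁ a₂ b z : ℂ) :
    Continuous fun w => Complex.regularizedHGFun {a₁, a₂} {b, f w, g w} z := by
  refine continuous_iff_continuousAt.mpr fun w₀ => ?_
  simp only [regularizedHGFun_eq_tsum]
  have hball := Metric.closedBall_mem_nhds w₀ one_pos
  obtain ⟨R, hR⟩ := (isCompact_closedBall w₀ 1).exists_bound_of_continuousOn hf.continuousOn
  obtain ⟨S, hS⟩ := (isCompact_closedBall w₀ 1).exists_bound_of_continuousOn hg.continuousOn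
  obtain ⟨C, hC0, hC⟩ := exists_norm_inv_Gamma_add_nat_le R
  obtain ⟨D, hD0, hD⟩ := exists_norm_inv_Gamma_add_nat_le S
  obtain ⟨E, hE0, hE⟩ := exists_norm_inv_Gamma_add_nat_le ‖b‖
  have hcont : Continuous fun s : ℂ => (Complex.Gamma s)⁻¹ :=
    Complex.differentiable_one_div_Gamma.continuous
  have hterm (w : ℂ) (n : ℕ) : Complex.regularizedHGFunCoeff {a₁, a₂} {b, f w, g w} n * z ^ n =
      (ascPochhammer ℂ n).eval a₁ * (ascPochhammer ℂ n).eval a₂ * (n ! : ℂ)⁻¹ *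
        ((Complex.Gamma (b + n))⁻¹ *
          ((Complex.Gamma (f w + n))⁻¹ * (Complex.Gamma (g w + n))⁻¹)) * z ^ n := by
    simp [Complex.regularizedHGFunCoeff, div_eq_mul_inv, mul_comm, mul_assoc]
  set K : ℝ := (‖a₁‖ + 1) * (‖a₂‖ + 1) * 8 * ‖z‖ with hK
  refine ContinuousOn.continuousAt (continuousOn_tsum
    (u := fun n => E * (C * D) * (K ^ n / n !)) (fun n => ?_) ?_ ?_) hball
  · simp only [hterm]
    refine Continuous.continuousOn ?_
    have h1 := hcont.comp (hf.add (continuous_const (y := (n : ℂ))))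
    have h2 := hcont.comp (hg.add (continuous_const (y := (n : ℂ))))
    exact (continuous_const.mul (continuous_const.mul (h1.mul h2))).mul continuous_const
  · exact (Real.summable_pow_div_factorial K).mul_left _
  · intro n w hw
    rw [hterm]
    simp only [norm_mul, norm_pow, norm_inv, Complex.norm_natCast]
    have h1 := norm_ascPochhammer_eval_le a₁ n
    have h2 := norm_ascPochhammer_eval_le a₂ n
    have h3 := hC (f w) (hR w hw) n
    have h4 := hD (g w) (hS w hw) n
    have h5 := hE b le_rfl n
    rw [norm_inv] at h3 h4 h5
    have h6 : (1 : ℝ) ≤ n ! := by exact_mod_cast n.factorial_pos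
    calc _ ≤ ((‖a₁‖ + 1) ^ n * n !) * ((‖a₂‖ + 1) ^ n * n !) * (n ! : ℝ)⁻¹ *
          ((E * (2 ^ n / n !)) * ((C * (2 ^ n / n !)) * (D * (2 ^ n / n !)))) * ‖z‖ ^ n := by
          gcongr
      _ = E * (C * D) * (K ^ n / n !) / n ! := by
          rw [hK, mul_pow, mul_pow, mul_pow, show (8 : ℝ) = 2 * (2 * 2) by norm_num, mul_pow,
            mul_pow]
          field_simp
      _ ≤ _ := div_le_self (by positivity) h6

/-! ### The two summands with a complex index -/

/-- The first summand of the factor with index `N`, in regularized hypergeometric functions, for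
complex `N`. -/
noncomputable def regFirst (L : ℕ) (N z : ℂ) : ℂ :=
  Complex.Gamma (L + 1) *
    Complex.regularizedHGFun {(L : ℂ) / 2 + 1 / 2, (L : ℂ) / 2}
      {(L : ℂ) + 1 / 2, (L : ℂ) / 2 - N / 2 + 1 / 2, (L : ℂ) / 2 + N / 2 + 1 / 2} (z / 4)

/-- The second summand of the factor with index `N`, in regularized hypergeometric functions, for
complex `N`. -/
noncomputable def regSecond (L : ℕ) (N z : ℂ) : ℂ :=
  1 / 16 * (L + 1) * Complex.Gamma (L + 2) * z *
    Complex.regularizedHGFun {(L : ℂ) / 2 + 1, (L : ℂ) / 2 + 3 / 2}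
      {(L : ℂ) + 5 / 2, (L : ℂ) / 2 - N / 2 + 3 / 2, (L : ℂ) / 2 + N / 2 + 3 / 2} (z / 4)

lemma regFactor_eq_add (L N : ℕ) (z : ℂ) :
    regFactor L N z = regFirst L N z + regSecond L N z := rfl

lemma continuous_regFirst (L : ℕ) (z : ℂ) : Continuous fun w => regFirst L w z :=
  continuous_const.mul (continuous_regularizedHGFun (by fun_prop) (by fun_prop) _ _ _ _)

lemma continuous_regSecond (L : ℕ) (z : ℂ) : Continuous fun w => regSecond L w z :=
  continuous_const.mul (continuous_regularizedHGFun (by fun_prop) (by fun_prop) _ _ _ _)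

lemma natCast_add_half_ne_neg_natCast (m k l : ℕ) (hl : Odd l) :
    (m : ℂ) + l / 2 ≠ -k := by
  intro h
  have h2 : ((2 * m + l + 2 * k : ℕ) : ℂ) = 0 := by
    push_cast
    linear_combination 2 * h
  have := hl.pos
  have h3 := Nat.cast_eq_zero.mp h2
  omega

/-- The two forms of the first summand agree unless a lower parameter is a pole of Gamma. -/
lemma convFirst_eq_regFirst {L : ℕ} (hL : L ≠ 0) {w : ℂ}
    (h₁ : ∀ k : ℕ, (L : ℂ) / 2 - w / 2 + 1 / 2 ≠ -k)
    (h₂ : ∀ k : ℕ, (L : ℂ) / 2 + w / 2 + 1 / 2 ≠ -k) (z : ℂ) :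
    convFirst L w z = regFirst L w z := by
  have h₀ (k : ℕ) : (L : ℂ) + 1 / 2 ≠ -k := by
    simpa using natCast_add_half_ne_neg_natCast L k 1 odd_one
  rw [convFirst, regFirst, hypergeom_eq_mul_regularizedHGFun (by simp [- one_div, h₀, h₁, h₂]),
    cbinom, Complex.Gamma_add_one _ (Nat.cast_ne_zero.mpr hL)]
  rw [show (2 * (L : ℂ) + 1) / 2 = L + 1 / 2 by ring, sub_add_cancel,
    show ((L : ℂ) - w - 1) / 2 + 1 = L / 2 - w / 2 + 1 / 2 by ring,
    show (L : ℂ) - 1 - (L - w - 1) / 2 + 1 = L / 2 + w / 2 + 1 / 2 by ring]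
  have g₀ := Complex.Gamma_ne_zero h₀
  have g₁ := Complex.Gamma_ne_zero h₁
  have g₂ := Complex.Gamma_ne_zero h₂
  simp only [Multiset.insert_eq_cons, Multiset.map_cons, Multiset.map_singleton,
    Multiset.prod_cons, Multiset.prod_singleton]
  generalize Complex.regularizedHGFun _ _ _ = F
  generalize Complex.Gamma ((L : ℂ) + 1 / 2) = G₀ at *
  generalize Complex.Gamma ((L : ℂ) / 2 - w / 2 + 1 / 2) = G₁ at *
  generalize Complex.Gamma ((L : ℂ) / 2 + w / 2 + 1 / 2) = G₂ at *
  field_simp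

/-- The two forms of the second summand agree unless a lower parameter is a pole of Gamma. -/
lemma convSecond_eq_regSecond (L : ℕ) {w : ℂ}
    (h₁ : ∀ k : ℕ, (L : ℂ) / 2 - w / 2 + 3 / 2 ≠ -k)
    (h₂ : ∀ k : ℕ, (L : ℂ) / 2 + w / 2 + 3 / 2 ≠ -k) (z : ℂ) :
    convSecond L w z = regSecond L w z := by
  have h₀ (k : ℕ) : (L : ℂ) + 5 / 2 ≠ -k := by
    simpa using natCast_add_half_ne_neg_natCast L k 5 (by decide)
  rw [convSecond, regSecond, hypergeom_eq_mul_regularizedHGFun (by simp [h₀, h₁, h₂]), cbinom]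
  rw [show (2 * (L : ℂ) + 5) / 2 = L + 5 / 2 by ring, show (L : ℂ) + 1 + 1 = L + 2 by ring,
    show ((L : ℂ) - w + 1) / 2 + 1 = L / 2 - w / 2 + 3 / 2 by ring,
    show (L : ℂ) + 1 - (L - w + 1) / 2 + 1 = L / 2 + w / 2 + 3 / 2 by ring]
  have g₀ := Complex.Gamma_ne_zero h₀
  have g₁ := Complex.Gamma_ne_zero h₁
  have g₂ := Complex.Gamma_ne_zero h₂
  simp only [Multiset.insert_eq_cons, Multiset.map_cons, Multiset.map_singleton,
    Multiset.prod_cons, Multiset.prod_singleton]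
  generalize Complex.regularizedHGFun _ _ _ = F
  generalize Complex.Gamma ((L : ℂ) + 5 / 2) = G₀ at *
  generalize Complex.Gamma ((L : ℂ) / 2 - w / 2 + 3 / 2) = G₁ at *
  generalize Complex.Gamma ((L : ℂ) / 2 + w / 2 + 3 / 2) = G₂ at *
  field_simp

/-- Near an integer, but away from it, no complex number is an integer. -/
lemma eventually_ne_intCast (N : ℕ) :
    ∀ᶠ w : ℂ in nhdsWithin (N : ℂ) {(N : ℂ)}ᶜ, ∀ k : ℤ, w ≠ k := by
  filter_upwards [self_mem_nhdsWithin, nhdsWithin_le_nhds (Metric.ball_mem_nhds _ one_pos)]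
    with w hw hw1 k rfl
  rw [Metric.mem_ball, Complex.dist_eq, ← Int.cast_natCast, ← Int.cast_sub,
    Complex.norm_intCast] at hw1
  have h : |k - (N : ℤ)| < 1 := by exact_mod_cast hw1
  rw [Int.abs_lt_one_iff, sub_eq_zero] at h
  exact hw (by simp [h])

lemma tendsto_convFirst {L : ℕ} (hL : L ≠ 0) (N : ℕ) (z : ℂ) :
    Filter.Tendsto (fun w : ℂ => convFirst L w z) (nhdsWithin (N : ℂ) {(N : ℂ)}ᶜ)
      (nhds (regFirst L N z)) := by
  refine Filter.Tendsto.congr' ?_ (((continuous_regFirst L z).tendsto (N : ℂ)).mono_left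
    nhdsWithin_le_nhds)
  filter_upwards [eventually_ne_intCast N] with w hw
  refine (convFirst_eq_regFirst hL (fun k h => hw (L + 1 + 2 * k) ?_)
    (fun k h => hw (-(L + 1 + 2 * k)) ?_) z).symm
  · push_cast
    linear_combination -2 * h
  · push_cast
    linear_combination 2 * h

lemma tendsto_convSecond (L N : ℕ) (z : ℂ) :
    Filter.Tendsto (fun w : ℂ => convSecond L w z) (nhdsWithin (N : ℂ) {(N : ℂ)}ᶜ)
      (nhds (regSecond L N z)) := by
  refine Filter.Tendsto.congr' ?_ (((continuous_regSecond L z).tendsto (N : ℂ)).mono_left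
    nhdsWithin_le_nhds)
  filter_upwards [eventually_ne_intCast N] with w hw
  refine (convSecond_eq_regSecond L (fun k h => hw (L + 3 + 2 * k) ?_)
    (fun k h => hw (-(L + 3 + 2 * k)) ?_) z).symm
  · push_cast
    linear_combination -2 * h
  · push_cast
    linear_combination 2 * h

lemma convFirst_natCast {L N : ℕ} (hL : L ≠ 0) (h : N ≤ L) (z : ℂ) :
    convFirst L N z = regFirst L N z := by
  refine convFirst_eq_regFirst hL (fun k hk => ?_) (fun k hk => ?_) z
  · have : ((L + 1 + 2 * k : ℕ) : ℂ) = N := by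
      push_cast
      linear_combination 2 * hk
    have := Nat.cast_injective this
    omega
  · have : ((L + N + 1 + 2 * k : ℕ) : ℂ) = (0 : ℕ) := by
      push_cast
      linear_combination 2 * hk
    have := Nat.cast_injective this
    omega

lemma convSecond_natCast {L N : ℕ} (h : N ≤ L + 2) (z : ℂ) :
    convSecond L N z = regSecond L N z := by
  refine convSecond_eq_regSecond L (fun k hk => ?_) (fun k hk => ?_) z
  · have : ((L + 3 + 2 * k : ℕ) : ℂ) = N := by
      push_cast
      linear_combination 2 * hk
    have := Nat.cast_injective this
    omega
  · have : ((L + N + 3 + 2 * k : ℕ) : ℂ) = (0 : ℕ) := by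
      push_cast
      linear_combination 2 * hk
    have := Nat.cast_injective this
    omega

/-- At `L = 0` and odd index the regularized first summand vanishes, in agreement with the
convention that the first summand is absent there. -/
lemma regFirst_zero_of_odd {N : ℕ} (hN : Odd N) (z : ℂ) : regFirst 0 N z = 0 := by
  rw [regFirst, regularizedHGFun_eq_tsum]
  refine mul_eq_zero_of_right _ ((tsum_congr fun n => ?_).trans tsum_zero)
  rcases n with _ | n
  · obtain ⟨m, rfl⟩ := hN
    rw [Complex.regularizedHGFunCoeff_eq_zero_right _ _ 0 m ?_, zero_mul]
    simp only [Multiset.insert_eq_cons, Multiset.mem_cons, Multiset.mem_singleton]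
    right; left
    push_cast
    ring
  · rw [Complex.regularizedHGFunCoeff_eq_zero_left _ _ (n + 1) 0 (by simp) (by omega), zero_mul]

/-! ### The factors as Legendre coefficients -/

/-- The duplication formula for Pochhammer symbols. -/
lemma ascPochhammer_eval_mul_half (x : ℂ) (n : ℕ) :
    4 ^ n * ((ascPochhammer ℂ n).eval x * (ascPochhammer ℂ n).eval (x + 1 / 2)) =
      (ascPochhammer ℂ (2 * n)).eval (2 * x) := by
  induction n with
  | zero => simp
  | succ n ih =>
    rw [show 2 * (n + 1) = 2 * n + 1 + 1 by ring]
    simp only [ascPochhammer_succ_eval, ← ih]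
    push_cast
    ring

lemma factorial_mul_ascPochhammer_eval_add_one (l n : ℕ) :
    (l ! : ℂ) * (ascPochhammer ℂ n).eval ((l : ℂ) + 1) = (l + n)! := by
  rw [factorial_mul_ascPochhammer]

lemma factorial_mul_ascPochhammer_eval_self (l n : ℕ) :
    (l ! : ℂ) * (ascPochhammer ℂ (n + 1)).eval (l : ℂ) = l * (l + n)! := by
  induction n with
  | zero => simp [mul_comm]
  | succ n ih =>
    rw [ascPochhammer_succ_eval, ← mul_assoc, ih, ← add_assoc, Nat.factorial_succ]
    push_cast
    ring

lemma natCast_add_natCast_add_half_ne_zero (m n : ℕ) : (m : ℂ) + n + 1 / 2 ≠ 0 := by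
  simpa using natCast_add_half_ne_neg_natCast (m + n) 0 1 odd_one

/-- The Legendre moments with the double factorial written as a Gamma value at a half-integer, the
form in which they appear in the coefficients of the factors. -/
lemma legendreMoment_eq_Gamma (L n : ℕ) :
    (legendreMoment L (L + 2 * n) : ℂ) =
      (√Real.pi : ℝ) * (L + 2 * n)! /
        (2 ^ L * 4 ^ n * n ! * ((L + n + 1 / 2) * Complex.Gamma (L + 1 / 2 + n))) := by
  have hG : ((L : ℂ) + n + 1 / 2) * Complex.Gamma (L + 1 / 2 + n) =
      ((2 * (L + n) + 1)‼ : ℂ) * (√Real.pi : ℝ) / 2 ^ (L + n + 1) := by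
    have h := Real.Gamma_nat_add_half (L + n + 1)
    have h0 := natCast_add_natCast_add_half_ne_zero L n
    rw [show (L : ℂ) + 1 / 2 + n = L + n + 1 / 2 by ring, ← Complex.Gamma_add_one _ h0,
      show (L : ℂ) + n + 1 / 2 + 1 = ((((L + n + 1 : ℕ) : ℝ) + 1 / 2 : ℝ) : ℂ) by push_cast; ring,
      Complex.Gamma_ofReal, h, show 2 * (L + n + 1) - 1 = 2 * (L + n) + 1 by omega]
    push_cast
    rfl
  have h1 : ((√Real.pi : ℝ) : ℂ) ≠ 0 := by
    exact_mod_cast (Real.sqrt_pos.mpr Real.pi_pos).ne'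
  have h2 : ((2 * (L + n) + 1)‼ : ℂ) ≠ 0 := by
    exact_mod_cast (Nat.doubleFactorial_pos _).ne'
  have h3 : (n ! : ℂ) ≠ 0 := by exact_mod_cast n.factorial_ne_zero
  rw [hG, legendreMoment_add_two_mul, show (4 : ℂ) = 2 * 2 by norm_num, mul_pow]
  push_cast
  field_simp
  ring

/-- The factor with index `N` as a single power series. The coefficients are Legendre moments
because `x * P_L` is a combination of `P_(L-1)` and `P_(L+1)`, which is what the two summands of
the factor stand for. -/
lemma regFactor_eq_tsum (L N : ℕ) (z : ℂ) :
    regFactor L N z = ∑' n : ℕ, (2 * L + 1) * 2 ^ L / (2 * (√Real.pi : ℝ)) *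
      (legendreMoment L (L + 2 * n) *
        ((Complex.Gamma (L / 2 - N / 2 + 1 / 2 + n))⁻¹ *
          (Complex.Gamma (L / 2 + N / 2 + 1 / 2 + n))⁻¹)) * (z / 4) ^ n := by
  have s1 := (summable_regularizedHGFunCoeff (a := {(L : ℂ) / 2 + 1 / 2, (L : ℂ) / 2})
    (b := {(L : ℂ) + 1 / 2, (L : ℂ) / 2 - N / 2 + 1 / 2, (L : ℂ) / 2 + N / 2 + 1 / 2})
    (by simp) (z / 4)).mul_left (Complex.Gamma (L + 1))
  have s2 := (summable_regularizedHGFunCoeff (a := {(L : ℂ) / 2 + 1, (L : ℂ) / 2 + 3 / 2})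
    (b := {(L : ℂ) + 5 / 2, (L : ℂ) / 2 - N / 2 + 3 / 2, (L : ℂ) / 2 + N / 2 + 3 / 2})
    (by simp) (z / 4)).mul_left (1 / 16 * (L + 1) * Complex.Gamma (L + 2) * z)
  have hpi : ((√Real.pi : ℝ) : ℂ) ≠ 0 := by
    exact_mod_cast (Real.sqrt_pos.mpr Real.pi_pos).ne'
  have hL2 : Complex.Gamma (L + 2) = (L + 1)! := by
    rw [← Complex.Gamma_nat_eq_factorial]
    push_cast
    ring_nf
  have hg (n : ℕ) : Complex.Gamma (L + 1 / 2 + n) ≠ 0 := Complex.Gamma_ne_zero_of_re_pos (by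
    simp; positivity)
  have hh := natCast_add_natCast_add_half_ne_zero L
  have t0 : Complex.Gamma (L + 1) * (Complex.regularizedHGFunCoeff
      {(L : ℂ) / 2 + 1 / 2, (L : ℂ) / 2}
      {(L : ℂ) + 1 / 2, (L : ℂ) / 2 - N / 2 + 1 / 2, (L : ℂ) / 2 + N / 2 + 1 / 2} 0 *
        (z / 4) ^ 0) =
      (2 * L + 1) * 2 ^ L / (2 * (√Real.pi : ℝ)) *
      (legendreMoment L (L + 2 * 0) *
        ((Complex.Gamma (L / 2 - N / 2 + 1 / 2 + (0 : ℕ)))⁻¹ *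
          (Complex.Gamma (L / 2 + N / 2 + 1 / 2 + (0 : ℕ)))⁻¹)) * (z / 4) ^ 0 := by
    rw [legendreMoment_eq_Gamma, Complex.regularizedHGFunCoeff, Complex.Gamma_nat_eq_factorial]
    simp only [Multiset.insert_eq_cons, Multiset.map_cons, Multiset.map_singleton,
      Multiset.prod_cons, Multiset.prod_singleton, div_eq_mul_inv _ (_ * _), mul_inv]
    have hG := hg 0
    have hH := hh 0
    generalize (Complex.Gamma ((L : ℂ) / 2 - N / 2 + 1 / 2 + (0 : ℕ)))⁻¹ = A at *
    generalize (Complex.Gamma ((L : ℂ) / 2 + N / 2 + 1 / 2 + (0 : ℕ)))⁻¹ = B at *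
    generalize Complex.Gamma ((L : ℂ) + 1 / 2 + (0 : ℕ)) = G at *
    simp only [ascPochhammer_zero, Polynomial.eval_one, Nat.factorial_zero]
    push_cast at *
    generalize hHe : (L : ℂ) + 0 + 1 / 2 = H at *
    field_simp
    rw [← hHe]
    simp [div_eq_mul_inv]
    ring
  -- The second series carries an additional `z`, so its `n`-th term goes with term `n + 1` of the
  -- first one.
  have t1 (n : ℕ) : Complex.Gamma (L + 1) * (Complex.regularizedHGFunCoeff
      {(L : ℂ) / 2 + 1 / 2, (L : ℂ) / 2}
      {(L : ℂ) + 1 / 2, (L : ℂ) / 2 - N / 2 + 1 / 2, (L : ℂ) / 2 + N / 2 + 1 / 2} (n + 1) *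
        (z / 4) ^ (n + 1)) +
      1 / 16 * (L + 1) * Complex.Gamma (L + 2) * z * (Complex.regularizedHGFunCoeff
      {(L : ℂ) / 2 + 1, (L : ℂ) / 2 + 3 / 2}
      {(L : ℂ) + 5 / 2, (L : ℂ) / 2 - N / 2 + 3 / 2, (L : ℂ) / 2 + N / 2 + 3 / 2} n *
        (z / 4) ^ n) =
      (2 * L + 1) * 2 ^ L / (2 * (√Real.pi : ℝ)) *
      (legendreMoment L (L + 2 * (n + 1)) *
        ((Complex.Gamma (L / 2 - N / 2 + 1 / 2 + (n + 1 : ℕ)))⁻¹ *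
          (Complex.Gamma (L / 2 + N / 2 + 1 / 2 + (n + 1 : ℕ)))⁻¹)) * (z / 4) ^ (n + 1) := by
    have p1 := factorial_mul_ascPochhammer_eval_self L (2 * n + 1)
    rw [show 2 * n + 1 + 1 = 2 * (n + 1) by ring,
      show (L : ℂ) = 2 * (L / 2) by ring, ← ascPochhammer_eval_mul_half,
      show 2 * ((L : ℂ) / 2) = L by ring] at p1
    have p2 := factorial_mul_ascPochhammer_eval_add_one (L + 1) (2 * n)
    rw [show ((L + 1 : ℕ) : ℂ) + 1 = 2 * (L / 2 + 1) by push_cast; ring,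
      ← ascPochhammer_eval_mul_half, show (L : ℂ) / 2 + 1 + 1 / 2 = L / 2 + 3 / 2 by ring] at p2
    have g1 : Complex.Gamma ((L : ℂ) + 5 / 2 + n) =
        (L + (n + 1 : ℕ) + 1 / 2) * Complex.Gamma (L + 1 / 2 + (n + 1 : ℕ)) := by
      rw [show (L : ℂ) + (n + 1 : ℕ) + 1 / 2 = L + 1 / 2 + (n + 1 : ℕ) by ring,
        ← Complex.Gamma_add_one]
      · push_cast
        ring_nf
      · have := hh (n + 1)
        rwa [show (L : ℂ) + (n + 1 : ℕ) + 1 / 2 = L + 1 / 2 + (n + 1 : ℕ) by ring] at this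
    rw [legendreMoment_eq_Gamma, Complex.regularizedHGFunCoeff, Complex.regularizedHGFunCoeff,
      Complex.Gamma_nat_eq_factorial, hL2]
    simp only [Multiset.insert_eq_cons, Multiset.map_cons, Multiset.map_singleton,
      Multiset.prod_cons, Multiset.prod_singleton, div_eq_mul_inv _ (_ * _), mul_inv]
    rw [g1, show (L : ℂ) / 2 - N / 2 + 3 / 2 + n = L / 2 - N / 2 + 1 / 2 + (n + 1 : ℕ) by
        push_cast; ring,
      show (L : ℂ) / 2 + N / 2 + 3 / 2 + n = L / 2 + N / 2 + 1 / 2 + (n + 1 : ℕ) by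
        push_cast; ring]
    have hG := hg (n + 1)
    have hH := hh (n + 1)
    generalize (Complex.Gamma ((L : ℂ) / 2 - N / 2 + 1 / 2 + (n + 1 : ℕ)))⁻¹ = A at *
    generalize (Complex.Gamma ((L : ℂ) / 2 + N / 2 + 1 / 2 + (n + 1 : ℕ)))⁻¹ = B at *
    generalize Complex.Gamma ((L : ℂ) + 1 / 2 + (n + 1 : ℕ)) = G at *
    rw [show L + (2 * n + 1) = L + 1 + 2 * n by ring] at p1
    rw [show L + 2 * (n + 1) = L + 1 + 2 * n + 1 by ring, Nat.factorial_succ (L + 1 + 2 * n),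
      Nat.factorial_succ n]
    have q1 : (L ! : ℂ) * ((ascPochhammer ℂ (n + 1)).eval ((L : ℂ) / 2 + 1 / 2) *
        (ascPochhammer ℂ (n + 1)).eval ((L : ℂ) / 2)) = L * (L + 1 + 2 * n)! / 4 ^ (n + 1) := by
      rw [eq_div_iff (pow_ne_zero _ (by norm_num)), ← p1]
      ring
    have q2 : ((L + 1)! : ℂ) * ((ascPochhammer ℂ n).eval ((L : ℂ) / 2 + 1) *
        (ascPochhammer ℂ n).eval ((L : ℂ) / 2 + 3 / 2)) = (L + 1 + 2 * n)! / 4 ^ n := by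
      rw [eq_div_iff (pow_ne_zero _ (by norm_num)), ← p2]
      ring
    have hn : (n : ℂ) + 1 ≠ 0 := by exact_mod_cast n.succ_ne_zero
    have hn' : (n ! : ℂ) ≠ 0 := by exact_mod_cast n.factorial_ne_zero
    calc _ = (L ! : ℂ) * ((ascPochhammer ℂ (n + 1)).eval ((L : ℂ) / 2 + 1 / 2) *
          (ascPochhammer ℂ (n + 1)).eval ((L : ℂ) / 2)) *
            ((n + 1 : ℂ)⁻¹ * (n ! : ℂ)⁻¹ * (G⁻¹ * (A * B)) * (z / 4) ^ (n + 1)) +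
          ((L + 1)! : ℂ) * ((ascPochhammer ℂ n).eval ((L : ℂ) / 2 + 1) *
            (ascPochhammer ℂ n).eval ((L : ℂ) / 2 + 3 / 2)) * (1 / 16 * (L + 1) * z *
              ((n ! : ℂ)⁻¹ * (((L : ℂ) + (n + 1 : ℕ) + 1 / 2)⁻¹ * G⁻¹ * (A * B))) *
                (z / 4) ^ n) := by
          push_cast
          simp only [mul_inv]
          ring
      _ = _ := by
          rw [q1, q2]
          push_cast at *
          generalize ((L + 1 + 2 * n)! : ℂ) = f
          rw [pow_succ (z / 4), pow_succ (4 : ℂ)]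
          generalize hHe : (L : ℂ) + (n + 1) + 1 / 2 = H at *
          field_simp
          rw [← hHe]
          ring
  rw [regFactor, regularizedHGFun_eq_tsum, regularizedHGFun_eq_tsum, ← tsum_mul_left,
    ← tsum_mul_left, s1.tsum_eq_zero_add, add_assoc,
    ← ((summable_nat_add_iff 1).mpr s1).tsum_add s2]
  have hs : Summable fun n : ℕ => (2 * L + 1) * 2 ^ L / (2 * (√Real.pi : ℝ)) *
      (legendreMoment L (L + 2 * n) *
        ((Complex.Gamma (L / 2 - N / 2 + 1 / 2 + n))⁻¹ *
          (Complex.Gamma (L / 2 + N / 2 + 1 / 2 + n))⁻¹)) * (z / 4) ^ n := by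
    rw [← summable_nat_add_iff 1]
    exact (((summable_nat_add_iff 1).mpr s1).add s2).congr t1
  rw [hs.tsum_eq_zero_add, t0]
  exact congrArg _ (tsum_congr t1)

/-- The coefficients of the Bessel-type series `∑ j, besselCoeff N z j * x ^ (N + 1 + 2 * j)`, whose
Legendre coefficients are the factors with index `N`, up to normalization. -/
noncomputable def besselCoeff (N : ℕ) (z : ℂ) (j : ℕ) : ℂ :=
  (z / 4) ^ j / (j ! * (N + j)!)

lemma summable_norm_besselCoeff (N : ℕ) (z : ℂ) : Summable fun j => ‖besselCoeff N z j‖ := by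
  refine (Real.summable_pow_div_factorial ‖z / 4‖).of_nonneg_of_le (fun _ => norm_nonneg _)
    fun j => ?_
  rw [besselCoeff, norm_div, norm_pow, norm_mul, Complex.norm_natCast, Complex.norm_natCast]
  gcongr
  exact le_mul_of_one_le_right (by positivity) (by exact_mod_cast Nat.factorial_pos _)

/-- The factor with index `N` is, up to normalization, the `L`-th Legendre coefficient of
`∑ j, besselCoeff N z j * x ^ (N + 1 + 2 * j)`. -/
lemma regFactor_eq_legendre {L N : ℕ} {e : ℤ} (he : (L : ℤ) + 2 * e = N + 1) {z : ℂ}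
    (hz : z ≠ 0) :
    regFactor L N z = (2 * L + 1) * 2 ^ L / (2 * (√Real.pi : ℝ)) * (z / 4) ^ e *
      ∑' j : ℕ, besselCoeff N z j * (legendreMoment L (N + 1 + 2 * j) : ℂ) := by
  have hz4 : z / 4 ≠ 0 := div_ne_zero hz (by norm_num)
  have G1 (j : ℕ) : Complex.Gamma (j + 1) = j ! := Complex.Gamma_nat_eq_factorial j
  have G2 (j : ℕ) : Complex.Gamma (N + j + 1) = (N + j)! := by
    rw [← Complex.Gamma_nat_eq_factorial, Nat.cast_add]
  rw [regFactor_eq_tsum, ← tsum_mul_left]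
  obtain ⟨i, rfl | rfl⟩ := e.eq_nat_or_neg
  -- For `L ≤ N + 1` the first terms of the factor vanish, as Mathlib's Gamma is zero at its poles.
  · have hN : N + 1 = L + 2 * i := by omega
    have hN' : (N : ℂ) = L + 2 * i - 1 := by
      rw [eq_sub_iff_add_eq]
      exact_mod_cast hN
    rw [← (add_left_injective i).tsum_eq]
    · refine tsum_congr fun j => ?_
      rw [show L + 2 * (j + i) = N + 1 + 2 * j by omega,
        show (L : ℂ) / 2 - N / 2 + 1 / 2 + (j + i : ℕ) = j + 1 by rw [hN']; push_cast; ring,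
        show (L : ℂ) / 2 + N / 2 + 1 / 2 + (j + i : ℕ) = N + j + 1 by rw [hN']; push_cast; ring,
        G1, G2, besselCoeff, zpow_natCast, pow_add]
      field_simp
    · intro n hn
      rw [Set.mem_range]
      by_contra! hni
      have hlt : n < i := by
        by_contra! hle
        exact hni (n - i) (Nat.sub_add_cancel hle)
      obtain ⟨k, rfl⟩ := Nat.exists_eq_add_of_lt hlt
      refine hn ?_
      beta_reduce
      rw [show (L : ℂ) / 2 - N / 2 + 1 / 2 + n = -(k : ℕ) by rw [hN']; push_cast; ring,
        Complex.Gamma_neg_nat_eq_zero]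
      simp
  -- For `N + 1 ≤ L` the monomials of degree less than `L` are orthogonal to `P_L`.
  · have hN : L = N + 1 + 2 * i := by omega
    have hN' : (L : ℂ) = N + 1 + 2 * i := by exact_mod_cast hN
    rw [← (add_left_injective i).tsum_eq (f := fun j => _ * (besselCoeff N z j * _))]
    · refine tsum_congr fun n => ?_
      rw [show L + 2 * n = N + 1 + 2 * (n + i) by omega,
        show (L : ℂ) / 2 - N / 2 + 1 / 2 + n = (n + i : ℕ) + 1 by rw [hN']; push_cast; ring,
        show (L : ℂ) / 2 + N / 2 + 1 / 2 + n = N + (n + i : ℕ) + 1 by rw [hN']; push_cast; ring,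
        G1, G2, besselCoeff, zpow_neg, zpow_natCast, pow_add]
      field_simp
    · intro j hj
      rw [Set.mem_range]
      by_contra! hji
      have hlt : j < i := by
        by_contra! hle
        exact hji (j - i) (Nat.sub_add_cancel hle)
      refine hj ?_
      beta_reduce
      rw [legendreMoment_eq_zero_of_lt (by omega)]
      simp

/-! ### The left-hand side as a double series -/

/-- Vandermonde's identity, in the form needed for the Cauchy product of two Bessel-type series. -/
lemma sum_antidiagonal_inv_factorial (μ ν n : ℕ) :
    ∑ x ∈ Finset.HasAntidiagonal.antidiagonal n,
        (1 : ℂ) / (x.1 ! * (μ + x.1)!) * (1 / (x.2 ! * (ν + x.2)!)) =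
      (μ + ν + 2 * n)! / (n ! * (μ + ν + n)! * ((μ + n)! * (ν + n)!)) := by
  have hf (k : ℕ) : (k ! : ℂ) ≠ 0 := by exact_mod_cast k.factorial_ne_zero
  have h := congrArg (Nat.cast (R := ℂ)) (Nat.add_choose_eq (ν + n) (μ + n) n)
  rw [Nat.cast_choose ℂ (by omega), show ν + n + (μ + n) = μ + ν + 2 * n by ring,
    show μ + ν + 2 * n - n = μ + ν + n by omega, Nat.cast_sum] at h
  rw [← div_div, h, Finset.sum_div]
  refine Finset.sum_congr rfl fun x hx => ?_
  obtain rfl := Finset.HasAntidiagonal.mem_antidiagonal.mp hx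
  rw [Nat.cast_mul, Nat.cast_choose ℂ (by omega), Nat.cast_choose ℂ (by omega),
    show ν + (x.1 + x.2) - x.1 = ν + x.2 by omega, show μ + (x.1 + x.2) - x.2 = μ + x.1 by omega]
  have := hf x.1
  have := hf x.2
  have := hf (μ + x.1)
  have := hf (ν + x.2)
  have := hf (ν + (x.1 + x.2))
  have := hf (μ + (x.1 + x.2))
  field_simp

lemma tsum_prod_eq_tsum_sum_antidiagonal {F : ℕ × ℕ → ℂ} (hF : Summable F) :
    ∑' x, F x = ∑' n, ∑ y ∈ Finset.HasAntidiagonal.antidiagonal n, F y := by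
  rw [← Finset.HasAntidiagonal.sigmaAntidiagonalEquivProd.tsum_eq F]
  refine ((Finset.HasAntidiagonal.sigmaAntidiagonalEquivProd.summable_iff.mpr
    hF).tsum_sigma).trans (tsum_congr fun n => ?_)
  rw [tsum_fintype]
  exact Finset.sum_coe_sort (Finset.HasAntidiagonal.antidiagonal n) F

lemma ascPochhammer_eval_mul_add (x : ℂ) (n : ℕ) :
    (ascPochhammer ℂ n).eval x * (x + n) = x * (ascPochhammer ℂ n).eval (x + 1) := by
  induction n with
  | zero => simp
  | succ n ih =>
    rw [ascPochhammer_succ_eval, ascPochhammer_succ_eval, ih]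
    push_cast
    ring

/-- The left-hand side as the integral over `[-1, 1]` of the product of the two Bessel-type series,
integrated term by term. -/
lemma lhs_eq_tsum {μ ν s : ℕ} (hs : μ + ν = 2 * s) (z : ℂ) :
    lhs μ ν z = (2 * s + 3) / 2 * (μ ! * ν !) *
      ∑' x : ℕ × ℕ, besselCoeff μ z x.1 * besselCoeff ν z x.2 *
        (2 / ((μ + 1 + 2 * x.1 : ℕ) + (ν + 1 + 2 * x.2 : ℕ) + 1)) := by
  have hf (k : ℕ) : (k ! : ℂ) ≠ 0 := by exact_mod_cast k.factorial_ne_zero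
  have hsC : (μ : ℂ) + ν = 2 * s := by exact_mod_cast hs
  have hsC' : (μ : ℂ) / 2 + ν / 2 = s := by rw [← add_div, hsC]; ring
  have hsum : Summable fun x : ℕ × ℕ => besselCoeff μ z x.1 * besselCoeff ν z x.2 *
      (2 / ((μ + 1 + 2 * x.1 : ℕ) + (ν + 1 + 2 * x.2 : ℕ) + 1)) := by
    refine Summable.of_norm (((summable_norm_besselCoeff μ z).mul_of_nonneg
      (summable_norm_besselCoeff ν z) (fun _ => norm_nonneg _) fun _ => norm_nonneg _).mul_right 2
        |>.of_nonneg_of_le (fun _ => norm_nonneg _) fun x => ?_)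
    rw [norm_mul, norm_mul]
    gcongr
    rw [← Nat.cast_add, ← Nat.cast_succ, norm_div, Complex.norm_natCast, Complex.norm_ofNat]
    exact div_le_self (by norm_num) (by norm_cast; omega)
  rw [tsum_prod_eq_tsum_sum_antidiagonal hsum, ← tsum_mul_left, lhs, hypergeom]
  refine tsum_congr fun n => ?_
  have hinner : ∑ y ∈ Finset.HasAntidiagonal.antidiagonal n, besselCoeff μ z y.1 * besselCoeff ν z y.2 *
      (2 / ((μ + 1 + 2 * y.1 : ℕ) + (ν + 1 + 2 * y.2 : ℕ) + 1)) =
      (2 * s + 2 * n)! / (n ! * (2 * s + n)! * ((μ + n)! * (ν + n)!)) *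
        ((z / 4) ^ n * (1 / (s + 3 / 2 + n))) := by
    rw [← hs, ← sum_antidiagonal_inv_factorial, Finset.sum_mul]
    refine Finset.sum_congr rfl fun y hy => ?_
    obtain rfl := Finset.HasAntidiagonal.mem_antidiagonal.mp hy
    have e : (((μ + 1 + 2 * y.1 : ℕ) : ℂ) + (ν + 1 + 2 * y.2 : ℕ) + 1) =
        2 * (s + 3 / 2 + (y.1 + y.2 : ℕ)) := by
      push_cast
      linear_combination hsC
    rw [e, besselCoeff, besselCoeff, pow_add, div_mul_cancel_left₀ two_ne_zero, one_div (_ + _)]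
    ring
  rw [hinner]
  simp only [Multiset.insert_eq_cons, Multiset.map_cons, Multiset.map_singleton,
    Multiset.prod_cons, Multiset.prod_singleton, hsC', hsC]
  have p1 := ascPochhammer_eval_mul_half ((s : ℂ) + 1 / 2) n
  rw [show (s : ℂ) + 1 / 2 + 1 / 2 = s + 1 by ring,
    show 2 * ((s : ℂ) + 1 / 2) = (2 * s : ℕ) + 1 by push_cast; ring] at p1
  have p2 := factorial_mul_ascPochhammer_eval_add_one (2 * s) (2 * n)
  have p3 := factorial_mul_ascPochhammer_eval_add_one (2 * s) n
  have p4 := factorial_mul_ascPochhammer_eval_add_one μ n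
  have p5 := factorial_mul_ascPochhammer_eval_add_one ν n
  have p6 := ascPochhammer_eval_mul_add ((s : ℂ) + 3 / 2) n
  rw [show (s : ℂ) + 3 / 2 + 1 = s + 5 / 2 by ring] at p6
  have h1 : (ascPochhammer ℂ n).eval ((s : ℂ) + 5 / 2) ≠ 0 := by
    have hk (k : ℕ) : (s : ℂ) + 5 / 2 ≠ -k := by
      simpa using natCast_add_half_ne_neg_natCast s k 5 (by decide)
    rw [← Complex.Gamma_add_nat_div_Gamma_eq _ hk]
    refine div_ne_zero (Complex.Gamma_ne_zero_of_re_pos ?_) (Complex.Gamma_ne_zero hk)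
    simp
    positivity
  have h2 : (s : ℂ) + 3 / 2 + n ≠ 0 := by
    have := natCast_add_half_ne_neg_natCast (s + n) 0 3 (by decide)
    push_cast at this
    rw [neg_zero] at this
    rwa [add_right_comm]
  rw [← p2, ← p1, ← p3, ← p4, ← p5, div_pow]
  push_cast
  have q3 : (ascPochhammer ℂ n).eval (2 * (s : ℂ) + 1) ≠ 0 := by
    intro h
    push_cast at p3
    rw [h, mul_zero] at p3
    exact hf _ p3.symm
  have q4 : (ascPochhammer ℂ n).eval ((μ : ℂ) + 1) ≠ 0 := by
    intro h
    rw [h, mul_zero] at p4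
    exact hf _ p4.symm
  have q5 : (ascPochhammer ℂ n).eval ((ν : ℂ) + 1) ≠ 0 := by
    intro h
    rw [h, mul_zero] at p5
    exact hf _ p5.symm
  have p7 : (ascPochhammer ℂ n).eval ((s : ℂ) + 3 / 2) =
      (s + 3 / 2) * (ascPochhammer ℂ n).eval ((s : ℂ) + 5 / 2) / (s + 3 / 2 + n) := by
    rw [eq_div_iff h2, p6]
  rw [p7]
  have := hf n
  have := hf μ
  have := hf ν
  have := hf (2 * s)
  clear p1 p2 p3 p4 p5 p6 p7 hinner hsum hf
  generalize (ascPochhammer ℂ n).eval ((s : ℂ) + 5 / 2) = a1 at *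
  generalize (ascPochhammer ℂ n).eval ((s : ℂ) + 1 / 2) = a2 at *
  generalize (ascPochhammer ℂ n).eval ((s : ℂ) + 1) = a3 at *
  generalize (ascPochhammer ℂ n).eval (2 * (s : ℂ) + 1) = a4 at *
  generalize (ascPochhammer ℂ n).eval ((μ : ℂ) + 1) = a5 at *
  generalize (ascPochhammer ℂ n).eval ((ν : ℂ) + 1) = a6 at *
  generalize (s : ℂ) + 3 / 2 + n = a7 at *
  field_simp

/-! ### The expansion -/

/-- The normalizing constants turn the product of the factors into the summand of Parseval's
identity for Legendre expansions. -/
lemma summand_eq_legendre {μ ν s : ℕ} (hs : μ + ν = 2 * s) {z : ℂ} (hz : z ≠ 0) (L : ℕ) :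
    prefactor μ ν z * (coeff μ ν z L * regFactor L μ z * regFactor L ν z) =
      (2 * s + 3) / 2 * (μ ! * ν !) * ((2 * L + 1) / 2 *
        ((∑' j, besselCoeff μ z j * (legendreMoment L (μ + 1 + 2 * j) : ℂ)) *
          ∑' k, besselCoeff ν z k * (legendreMoment L (ν + 1 + 2 * k) : ℂ))) := by
  rcases Nat.even_or_odd (L + μ + 1) with hpar | hpar
  · have hpar' : Even (L + ν + 1) := by
      rw [Nat.even_iff] at *
      omega
    obtain ⟨r, hr⟩ := hpar
    obtain ⟨t, ht⟩ := hpar'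
    rw [regFactor_eq_legendre (e := r - L) (by omega) hz,
      regFactor_eq_legendre (e := t - L) (by omega) hz]
    generalize ∑' j, besselCoeff μ z j * (legendreMoment L (μ + 1 + 2 * j) : ℂ) = S
    generalize ∑' j, besselCoeff ν z j * (legendreMoment L (ν + 1 + 2 * j) : ℂ) = T
    have hz4 : z / 4 ≠ 0 := div_ne_zero hz (by norm_num)
    have hsC : (μ : ℂ) + ν = 2 * s := by exact_mod_cast hs
    -- The two powers of `z / 4` have the total exponent `(μ + ν) / 2 + 1 - L`.
    have hpow : (z / 4) ^ ((r : ℤ) - L) * (z / 4) ^ ((t : ℤ) - L) =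
        (z / 4) ^ s * (z / 4) / (z / 4) ^ L := by
      rw [← zpow_add₀ hz4, show (r : ℤ) - L + (t - L) = s + 1 - L by omega, zpow_sub₀ hz4,
        zpow_add_one₀ hz4, zpow_natCast, zpow_natCast]
    have hpi : ((√Real.pi : ℝ) : ℂ) * (√Real.pi : ℝ) = Real.pi := by
      rw [← Complex.ofReal_mul, Real.mul_self_sqrt Real.pi_pos.le]
    have hpi0 : ((√Real.pi : ℝ) : ℂ) ≠ 0 := by
      exact_mod_cast (Real.sqrt_pos.mpr Real.pi_pos).ne'
    have hI : Complex.I ^ (2 : ℤ) = -1 := by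
      rw [show (2 : ℤ) = (2 : ℕ) by rfl, zpow_natCast, Complex.I_sq]
    have hI1 : Complex.I ^ (-(μ : ℤ) - ν) = (-1) ^ s := by
      rw [show -(μ : ℤ) - ν = 2 * (-s) by omega, zpow_mul, hI, zpow_neg, zpow_natCast,
        ← inv_pow, inv_neg_one]
    have hI2 : Complex.I ^ (2 * (L : ℤ) - 2) = -(-1) ^ L := by
      rw [show 2 * (L : ℤ) - 2 = 2 * (L - 1) by ring, zpow_mul, hI, zpow_sub_one₀ (by norm_num),
        zpow_natCast, inv_neg_one]
      ring
    have h21 : (2 : ℂ) ^ ((μ : ℤ) + ν - 2) = 4 ^ s / 4 := by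
      rw [show (μ : ℤ) + ν - 2 = 2 * s - 2 by omega, zpow_sub₀ two_ne_zero, zpow_mul,
        zpow_natCast]
      norm_num
    have h22 : (2 : ℂ) ^ (2 - 4 * (L : ℤ)) = 4 / (4 ^ L * 4 ^ L) := by
      rw [zpow_sub₀ two_ne_zero, zpow_mul, zpow_natCast, ← mul_pow]
      norm_num
    have hm : (-1 : ℂ) ^ ((L : ℂ) - μ / 2 - ν / 2 - 1) = -((-1) ^ L * (-1) ^ s) := by
      rw [show (L : ℂ) - μ / 2 - ν / 2 - 1 = ((L - s - 1 : ℤ) : ℂ) by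
          push_cast
          linear_combination -hsC / 2,
        Complex.cpow_intCast, zpow_sub_one₀ (by norm_num), zpow_sub₀ (by norm_num), zpow_natCast,
        zpow_natCast, inv_neg_one, div_eq_mul_inv, ← inv_pow, inv_neg_one]
      ring
    have hzs : z ^ ((1 / 2 : ℂ) * (-(μ : ℂ) - ν)) = (z ^ s)⁻¹ := by
      rw [show (1 / 2 : ℂ) * (-(μ : ℂ) - ν) = ((-s : ℤ) : ℂ) by
          push_cast
          linear_combination -hsC / 2,
        Complex.cpow_intCast, zpow_neg, zpow_natCast]
    have hzL : z ^ ((L : ℤ) - 1) = z ^ L / z := by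
      rw [zpow_sub_one₀ hz, zpow_natCast, div_eq_mul_inv]
    have hL1 : (2 * (L : ℂ) + 1) ≠ 0 := by exact_mod_cast (2 * L).succ_ne_zero
    have e1 : (-1 : ℂ) ^ (L + μ + 1) = 1 := (even_iff_exists_two_mul.mpr ⟨r, by omega⟩).neg_one_pow
    have e2 : (-1 : ℂ) ^ (L + ν + 1) = 1 := (even_iff_exists_two_mul.mpr ⟨t, by omega⟩).neg_one_pow
    have sL : ((-1 : ℂ) ^ L) * (-1) ^ L = 1 := by rw [← mul_pow]; simp
    have ss : ((-1 : ℂ) ^ s) * (-1) ^ s = 1 := by rw [← mul_pow]; simp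
    rw [prefactor, coeff, hI1, hI2, h21, h22, hm, hzs, hzL, e1, e2, hsC,
      Complex.Gamma_nat_eq_factorial, Complex.Gamma_nat_eq_factorial, ← hpi]
    have h2L : (2 : ℂ) ^ L * 2 ^ L = 4 ^ L := by rw [← mul_pow]; norm_num
    calc _ = (((-1 : ℂ) ^ L) * (-1) ^ L) * (((-1 : ℂ) ^ s) * (-1) ^ s) *
          ((2 : ℂ) ^ L * 2 ^ L) * ((z / 4) ^ ((r : ℤ) - L) * (z / 4) ^ ((t : ℤ) - L)) *
          (((√Real.pi : ℝ) * (√Real.pi : ℝ) * (4 ^ s / 4) * μ ! * ν ! * (2 * s + 3) * (z ^ s)⁻¹) *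
            (4 / (4 ^ L * 4 ^ L) * 4 / (2 * L + 1) * (z ^ L / z)) *
            ((2 * L + 1) / (2 * (√Real.pi : ℝ)) * ((2 * L + 1) / (2 * (√Real.pi : ℝ)))) *
            (S * T)) := by ring
      _ = _ := by
          rw [sL, ss, h2L, hpow, div_pow, div_pow]
          have := pow_ne_zero L hz
          have := pow_ne_zero s hz
          generalize ((√Real.pi : ℝ) : ℂ) = p at *
          field_simp
  -- For the other parity of `L` both sides vanish.
  · have h0 (j : ℕ) : legendreMoment L (μ + 1 + 2 * j) = 0 := by
      refine legendreMoment_eq_zero_of_odd ?_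
      rw [Nat.odd_iff] at *
      omega
    simp [coeff, hpar.neg_one_pow, h0]

end HypergeometricSum

open HypergeometricSum in
theorem mainTheorem2 (μ ν : ℕ) (hpar : Even (μ + ν)) (z : ℂ) (hz : z ≠ 0) :
    -- the form with conventional hypergeometric functions, where `P N L` and `Q N L` are the
    -- values (by continuity in the index `N`) of the two summands of the factor with index `N`
    (∃ P Q : ℕ → ℕ → ℂ,
      (∀ N ∈ ({μ, ν} : Set ℕ), ∀ L : ℕ,
        Filter.Tendsto (fun w : ℂ => HypergeometricSum.convFirst L w z)
          (nhdsWithin (N : ℂ) {(N : ℂ)}ᶜ) (nhds (P N L)) ∧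
        Filter.Tendsto (fun w : ℂ => HypergeometricSum.convSecond L w z)
          (nhdsWithin (N : ℂ) {(N : ℂ)}ᶜ) (nhds (Q N L)) ∧
        (N ≤ L → P N L = HypergeometricSum.convFirst L N z) ∧
        (N ≤ L + 2 → Q N L = HypergeometricSum.convSecond L N z)) ∧
      HasSum
        (fun L : ℕ => HypergeometricSum.prefactor μ ν z *
          (HypergeometricSum.coeff μ ν z L * (P μ L + Q μ L) * (P ν L + Q ν L)))
        (HypergeometricSum.lhs μ ν z)) ∧
    -- the form with regularized hypergeometric functions
    HasSum
      (fun L : ℕ => HypergeometricSum.prefactor μ ν z *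
        (HypergeometricSum.coeff μ ν z L *
          HypergeometricSum.regFactor L μ z * HypergeometricSum.regFactor L ν z))
      (HypergeometricSum.lhs μ ν z) := by
  obtain ⟨s, hs⟩ := even_iff_exists_two_mul.mp hpar
  have hreg : HasSum (fun L : ℕ => prefactor μ ν z *
      (coeff μ ν z L * regFactor L μ z * regFactor L ν z)) (lhs μ ν z) := by
    simp only [summand_eq_legendre hs hz, lhs_eq_tsum hs]
    exact (hasSum_legendre_parseval (summable_norm_besselCoeff μ z)
      (summable_norm_besselCoeff ν z) fun j k => ⟨s + 1 + j + k, by omega⟩).mul_left _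
  refine ⟨⟨fun N L => if L = 0 then 0 else regFirst L N z, fun N L => regSecond L N z,
    fun N _ L => ⟨?_, tendsto_convSecond L N z, fun h => ?_,
      fun h => (convSecond_natCast h z).symm⟩, ?_⟩, hreg⟩
  · beta_reduce
    split_ifs with hL
    · subst hL
      simp [convFirst]
    · exact tendsto_convFirst hL N z
  · beta_reduce
    split_ifs with hL
    · subst hL
      simp [convFirst]
    · exact (convFirst_natCast hL h z).symm
  · suffices h : ∀ L, coeff μ ν z L * ((if L = 0 then 0 else regFirst L μ z) + regSecond L μ z) *
        ((if L = 0 then 0 else regFirst L ν z) + regSecond L ν z) =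
        coeff μ ν z L * regFactor L μ z * regFactor L ν z by
      simpa only [h] using hreg
    intro L
    rcases Nat.eq_zero_or_pos L with rfl | hL
    -- At `L = 0` the first summands agree for odd indices; for even ones the coefficient vanishes.
    · rcases Nat.even_or_odd μ with hμ | hμ
      · have : coeff μ ν z 0 = 0 := by
          simp [coeff, (hμ.add_one).neg_one_pow]
        rw [this]
        ring
      · have hν : Odd ν := by
          rw [Nat.odd_iff] at *
          omega
        simp only [regFactor_eq_add, regFirst_zero_of_odd hμ, regFirst_zero_of_odd hν, if_true]
    · simp only [regFactor_eq_add, if_neg hL.ne']
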